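/- Let $\mathbb X$ be a Polish space with its Borel $\sigma$-algebra, and let the space of probability measures on $\mathbb X$ carry the topology of weak convergence. Let $(X_n)_{n\ge1}$ be an exchangeable sequence of $\mathbb X$-valued random variables on a probability space $(\Omega,\mathcal F,\mathbb P)$ (its law is invariant under all finite permutations of the indices), let $P_0$ be the law of $X_1$, let $\hat F_n=\frac1n\sum_{i=1}^n\delta_{X_i}$, and let $\tilde F$ be the directing random measure, i.e. the random probability measure with $\hat F_n\to\tilde F$ weakly, $\mathbb P$-a.s. Let $\mathcal M$ be a measurable set of probability measures on $\mathbb X$ such that $\mathbb P(\tilde F\in\mathcal M)=1$ and $\mathbb P(\hat F_n\in\mathcal M)=1$ for every $n\ge1$, let $\mathbb T\subseteq\mathbb R^k$ be a Borel set, and let $T:\mathcal M\to\mathbb T$ be continuous. Put $T_n=T(\hat F_n)$ and assume that $T_n$ is predictive sufficient: for every $n\ge1$ the predictive distribution $P_n(\cdot)=\mathbb P(X_{n+1}\in\cdot\mid X_1,\dots,X_n)$ is $\mathbb P$-a.s. a (measurable) function of $T_n$. For $n\ge1$ let $q_n(\cdot,t)=\mathbb P(X_{n+1}\in\cdot\mid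 T_n=t)$, $t\in\mathbb T$, be a regular version of the conditional distribution of $X_{n+1}$ given $T_n$. Assume that for every Borel set $A\subseteq\mathbb X$ with $P_0(\partial A)=0$ the functions $q_n(A,\cdot)$ are continuous on $\mathbb T$ uniformly in $t$ and $n$, i.e. for every $\varepsilon>0$ there is $\delta>0$ such that $|q_n(A,s)-q_n(A,t)|<\varepsilon$ for all $n\ge1$ and all $s,t\in\mathbb T$ with $|s-t|<\delta$. Then there exists a probability kernel $F(\cdot\mid\theta)$, $\theta\in\mathbb T$, on $\mathbb X$ (measurable in $\theta$) such that, with $\tilde\theta=T(\tilde F)$, $\mathbb P$-a.s. $\tilde F(\cdot)=F(\cdot\mid\tilde\theta)$ as probability measures, and $T_n\to\tilde\theta$, $\mathbb P$-a.s. -/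

import Mathlib

open MeasureTheory ProbabilityTheory Filter Topology

noncomputable section

namespace PredictiveSufficiency

/-- The sequence `X` is exchangeable under `μ`: its law is invariant under every permutation of
the indices that moves only finitely many of them. -/
def Exchangeable {Ω 𝕏 : Type*} [MeasurableSpace Ω] [MeasurableSpace 𝕏]
    (X : ℕ → Ω → 𝕏) (μ : Measure Ω) : Prop :=
  ∀ σ : Equiv.Perm ℕ, {i | σ i ≠ i}.Finite →
    IdentDistrib (fun ω i => X (σ i) ω) (fun ω i => X i ω) μ μ

/-- The empirical distribution of the first `n + 1` terms `x 0, …, x n` of a sequence. -/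
def empiricalMeasure {𝕏 : Type*} [MeasurableSpace 𝕏] (x : ℕ → 𝕏) (n : ℕ) :
    ProbabilityMeasure 𝕏 :=
  ⟨((n + 1 : ℕ) : ENNReal)⁻¹ • ∑ i ∈ Finset.range (n + 1), Measure.dirac (x i), ⟨by
    simp only [Measure.smul_apply, Measure.finsetSum_apply, measure_univ, Finset.sum_const,
      Finset.card_range, smul_eq_mul, nsmul_eq_mul, mul_one]
    exact ENNReal.inv_mul_cancel (by simp) (ENNReal.natCast_ne_top _)⟩⟩

/-- `Fdir` is the directing random measure of the sequence `X`: a random probability measure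
that is almost surely the weak limit of the empirical distributions. -/
def IsDirectingMeasure {Ω 𝕏 : Type*} [MeasurableSpace Ω] [MeasurableSpace 𝕏]
    [TopologicalSpace 𝕏] [OpensMeasurableSpace 𝕏]
    (X : ℕ → Ω → 𝕏) (μ : Measure Ω) (Fdir : Ω → ProbabilityMeasure 𝕏) : Prop :=
  Measurable Fdir ∧
    ∀ᵐ ω ∂μ, Tendsto (fun n => empiricalMeasure (fun i => X i ω) n) atTop (𝓝 (Fdir ω))

/-- The predictive distribution of `X (n + 1)` given the first `n + 1` observations
`X 0, …, X n`, a regular conditional distribution. -/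
def predictive {Ω 𝕏 : Type*} [MeasurableSpace Ω] [MeasurableSpace 𝕏] [StandardBorelSpace 𝕏]
    [Nonempty 𝕏] (X : ℕ → Ω → 𝕏) (μ : Measure Ω) [IsFiniteMeasure μ] (n : ℕ) (ω : Ω) :
    Measure 𝕏 :=
  condDistrib (X (n + 1)) (fun ω' (i : Fin (n + 1)) => X i ω') μ (fun i => X i ω)

/-- The statistic `T`, applied to the empirical distribution, is predictive sufficient: for every
sample size, the predictive distribution is almost surely a (measurable) function of the value
of the statistic. -/
def IsPredictiveSufficient {Ω 𝕏 E : Type*} [MeasurableSpace Ω] [MeasurableSpace 𝕏]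
    [StandardBorelSpace 𝕏] [Nonempty 𝕏] [MeasurableSpace E]
    (X : ℕ → Ω → 𝕏) (μ : Measure Ω) [IsFiniteMeasure μ] (T : ProbabilityMeasure 𝕏 → E) : Prop :=
  ∀ n : ℕ, ∃ κ : Kernel E 𝕏, IsMarkovKernel κ ∧
    ∀ᵐ ω ∂μ, predictive X μ n ω = κ (T (empiricalMeasure (fun i => X i ω) n))

end PredictiveSufficiency

end

open scoped ENNReal NNReal BoundedContinuousFunction

namespace PredictiveSufficiency

/-! ### Empirical measures: integrals, measurability, continuity. -/

section Empirical

variable {𝕏 : Type*} [MeasurableSpace 𝕏]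

/-! Given the past, all later terms have the same law; averaging them and passing to the weak limit
shows that the predictive probability of `A` is the conditional expectation of F̃(A)
(`IsDirectingMeasure.condExp_ae_eq`). If P₀(∂A) = 0, F̃(A) is an a.s. limit of empirical
frequencies, so Lévy's upward theorem makes these probabilities converge to F̃(A)
(`IsDirectingMeasure.tendsto_condExp`). By sufficiency they equal q_n(A, T_n). Since T_n → θ̃ by
continuity of T, uniform equicontinuity replaces T_n by θ̃, and q_n(A, θ̃) → F̃(A).

Thus F̃(A) is a function of θ̃ for every `A` in a generating π-system, and
`exists_kernel_ae_eq_comp` assembles these functions into one kernel. De Finetti's representation is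
not needed. -/

lemma lintegral_empiricalMeasure (x : ℕ → 𝕏) (n : ℕ) {f : 𝕏 → ℝ≥0∞} (hf : Measurable f) :
    ∫⁻ y, f y ∂(empiricalMeasure x n : Measure 𝕏) =
      ((n + 1 : ℕ) : ℝ≥0∞)⁻¹ * ∑ i ∈ Finset.range (n + 1), f (x i) := by
  simp only [empiricalMeasure, ProbabilityMeasure.coe_mk, lintegral_smul_measure, smul_eq_mul,
    lintegral_finsetSum_measure, lintegral_dirac' _ hf]

lemma empiricalMeasure_apply (x : ℕ → 𝕏) (n : ℕ) {A : Set 𝕏} (hA : MeasurableSet A) :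
    (empiricalMeasure x n : Measure 𝕏) A =
      ((n + 1 : ℕ) : ℝ≥0∞)⁻¹ * ∑ i ∈ Finset.range (n + 1), A.indicator 1 (x i) := by
  rw [← lintegral_empiricalMeasure x n (measurable_one.indicator hA), lintegral_indicator_one hA]

lemma measurable_empiricalMeasure {α : Type*} [MeasurableSpace α] (n : ℕ) {X : ℕ → α → 𝕏}
    (hX : ∀ i ≤ n, Measurable (X i)) :
    Measurable fun a => empiricalMeasure (fun i => X i a) n := by
  refine Measurable.subtype_mk (Measure.measurable_of_measurable_coe _ fun A hA => ?_)
  have h : (fun a => ((empiricalMeasure (fun i => X i a) n : ProbabilityMeasure 𝕏) : Measure 𝕏) A)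
      = fun a => ((n + 1 : ℕ) : ℝ≥0∞)⁻¹ *
        ∑ i ∈ Finset.range (n + 1), A.indicator 1 (X i a) := by
    ext a
    exact empiricalMeasure_apply _ n hA
  change Measurable fun a =>
    ((empiricalMeasure (fun i => X i a) n : ProbabilityMeasure 𝕏) : Measure 𝕏) A
  rw [h]
  refine Measurable.const_mul (Finset.measurable_fun_sum _ fun i hi => ?_) _
  exact (measurable_one.indicator hA).comp (hX i (Nat.lt_succ_iff.1 (Finset.mem_range.1 hi)))

lemma continuous_empiricalMeasure [TopologicalSpace 𝕏] [OpensMeasurableSpace 𝕏] (n : ℕ) :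
    Continuous fun x : ℕ → 𝕏 => empiricalMeasure x n := by
  rw [continuous_iff_continuousAt]
  intro x
  refine ProbabilityMeasure.tendsto_iff_forall_lintegral_tendsto.2 fun f => ?_
  have hf : Measurable fun y => (f y : ℝ≥0∞) := f.continuous.measurable.coe_nnreal_ennreal
  simp only [lintegral_empiricalMeasure _ n hf]
  have hc : Continuous fun z : ℕ → 𝕏 => ∑ i ∈ Finset.range (n + 1), (f (z i) : ℝ≥0∞) :=
    continuous_finsetSum _ fun i _ =>
      ENNReal.continuous_coe.comp (f.continuous.comp (continuous_apply i))
  exact ENNReal.Tendsto.const_mul hc.continuousAt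
    (Or.inr (ENNReal.inv_ne_top.2 (by simp)))

/-- A statistic that is continuous on a measurable set of probability measures is a.e. measurable
along empirical measures that almost surely lie in that set. -/
lemma aemeasurable_comp_empiricalMeasure {Ω E : Type*} [MeasurableSpace Ω] {μ : Measure Ω}
    [TopologicalSpace 𝕏] [SecondCountableTopology 𝕏] [BorelSpace 𝕏]
    [TopologicalSpace E] [MeasurableSpace E] [BorelSpace E]
    {X : ℕ → Ω → 𝕏} (hX : ∀ i, Measurable (X i)) {M : Set (ProbabilityMeasure 𝕏)}
    (hM : MeasurableSet M) {T : ProbabilityMeasure 𝕏 → E} (hT : ContinuousOn T M) {n : ℕ}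
    (hemp : ∀ᵐ ω ∂μ, empiricalMeasure (fun i => X i ω) n ∈ M) :
    AEMeasurable (fun ω => T (empiricalMeasure (fun i => X i ω) n)) μ := by
  have hpath : Measurable fun ω i => X i ω := measurable_pi_lambda _ hX
  let S : Set (ℕ → 𝕏) := (fun x => empiricalMeasure x n) ⁻¹' M
  have hS : MeasurableSet S :=
    measurable_empiricalMeasure n (X := fun i (x : ℕ → 𝕏) => x i)
      (fun i _ => measurable_pi_apply i) hM
  have hcont : ContinuousOn (fun x : ℕ → 𝕏 => T (empiricalMeasure x n)) S :=
    hT.comp (continuous_empiricalMeasure n).continuousOn fun _ hx => hx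
  have hae : AEMeasurable (fun x : ℕ → 𝕏 => T (empiricalMeasure x n))
      (μ.map fun ω i => X i ω) := by
    -- Continuity on `S` controls only the restricted law, but `S` has full measure.
    have h := hcont.aemeasurable (μ := μ.map fun ω i => X i ω) hS
    rwa [Measure.restrict_eq_self_of_ae_mem] at h
    exact (ae_map_iff hpath.aemeasurable hS).2 hemp
  exact hae.comp_measurable hpath

end Empirical

/-! ### Exchangeability and the mean of the directing measure. -/

/-- If the terms of a sequence, from some index on, have the same law and the empirical measures
converge weakly, then this law is the mean of the limiting random measure. -/
lemma map_eq_bind_of_tendsto_empiricalMeasure {Ω 𝕏 : Type*} [MeasurableSpace Ω]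
    [TopologicalSpace 𝕏] [MeasurableSpace 𝕏] [BorelSpace 𝕏] [HasOuterApproxClosed 𝕏]
    {ν : Measure Ω} [IsFiniteMeasure ν] {X : ℕ → Ω → 𝕏} (hX : ∀ i, Measurable (X i))
    {Fdir : Ω → ProbabilityMeasure 𝕏} (hF : Measurable Fdir)
    (hlim : ∀ᵐ ω ∂ν, Tendsto (fun n => empiricalMeasure (fun i => X i ω) n) atTop (𝓝 (Fdir ω)))
    {m₀ : ℕ} (hlaw : ∀ m ≥ m₀, ν.map (X m) = ν.map (X m₀)) :
    ν.map (X m₀) = ν.bind fun ω => (Fdir ω : Measure 𝕏) := by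
  have hF' : Measurable fun ω => (Fdir ω : Measure 𝕏) := measurable_subtype_coe.comp hF
  have : IsFiniteMeasure (ν.bind fun ω => (Fdir ω : Measure 𝕏)) := by
    refine ⟨?_⟩
    rw [Measure.bind_apply MeasurableSet.univ hF'.aemeasurable]
    simp
  refine ext_of_forall_lintegral_eq_of_IsFiniteMeasure fun f => ?_
  have hf : Measurable fun y => (f y : ℝ≥0∞) := f.continuous.measurable.coe_nnreal_ennreal
  rw [Measure.lintegral_bind hF'.aemeasurable hf.aemeasurable]
  let a : ℕ → ℝ≥0∞ := fun m => ∫⁻ y, f y ∂ν.map (X m)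
  have ha : ∀ m, a m ≠ ∞ := fun m => (f.lintegral_lt_top_of_nnreal (ν.map (X m))).ne
  have h₁ : Tendsto (fun n => ∫⁻ ω, ∫⁻ y, f y
      ∂(empiricalMeasure (fun i => X i ω) n : Measure 𝕏) ∂ν) atTop
      (𝓝 (∫⁻ ω, ∫⁻ y, f y ∂(Fdir ω : Measure 𝕏) ∂ν)) := by
    refine tendsto_lintegral_of_dominated_convergence (fun _ => (nndist f 0 : ℝ≥0∞)) (fun n => ?_)
      (fun n => .of_forall fun ω => ?_) ?_ ?_
    · exact (Measure.measurable_lintegral hf).comp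
        (measurable_subtype_coe.comp (measurable_empiricalMeasure n fun i _ => hX i))
    · refine (lintegral_mono (g := fun _ => (nndist f 0 : ℝ≥0∞)) fun y => ?_).trans (by simp)
      exact ENNReal.coe_le_coe.2 (BoundedContinuousFunction.NNReal.upper_bound f y)
    · rw [lintegral_const]
      exact ENNReal.mul_ne_top ENNReal.coe_ne_top (measure_ne_top ν _)
    · filter_upwards [hlim] with ω hω
      exact ProbabilityMeasure.tendsto_iff_forall_lintegral_tendsto.1 hω f
  have h₂ : ∀ n, ∫⁻ ω, ∫⁻ y, f y ∂(empiricalMeasure (fun i => X i ω) n : Measure 𝕏) ∂ν =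
      ENNReal.ofReal (((n + 1 : ℕ) : ℝ)⁻¹ * ∑ i ∈ Finset.range (n + 1), (a i).toReal) := by
    intro n
    simp only [lintegral_empiricalMeasure _ n hf]
    have hfX : ∀ i, Measurable fun ω => (f (X i ω) : ℝ≥0∞) := fun i => hf.comp (hX i)
    rw [lintegral_const_mul _ (Finset.measurable_fun_sum _ fun i _ => hfX i),
      lintegral_finsetSum _ fun i _ => hfX i, ENNReal.ofReal_mul (by positivity),
      ENNReal.ofReal_inv_of_pos (by positivity), ENNReal.ofReal_natCast,
      ENNReal.ofReal_sum_of_nonneg fun _ _ => ENNReal.toReal_nonneg]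
    congr 1
    refine Finset.sum_congr rfl fun i _ => ?_
    rw [ENNReal.ofReal_toReal (ha i)]
    exact (lintegral_map hf (hX i)).symm
  have h₃ : Tendsto (fun m => (a m).toReal) atTop (𝓝 (a m₀).toReal) := by
    refine tendsto_const_nhds.congr' ?_
    filter_upwards [eventually_ge_atTop m₀] with m hm
    simp only [a, hlaw m hm]
  -- Cesàro means ignore the terms before `m₀`; the shift is there because index `n` averages `n +
  -- 1` terms.
  have h₄ := ENNReal.tendsto_ofReal (h₃.cesaro.comp (tendsto_add_atTop_nat 1))
  rw [ENNReal.ofReal_toReal (ha m₀)] at h₄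
  simp only [h₂] at h₁
  exact tendsto_nhds_unique h₄ h₁

/-- Given the past, all future terms of an exchangeable sequence have the same law. -/
lemma Exchangeable.restrict_map_eq {Ω 𝕏 : Type*} [MeasurableSpace Ω] [MeasurableSpace 𝕏]
    {μ : Measure Ω} {X : ℕ → Ω → 𝕏} (hexch : Exchangeable X μ) (hX : ∀ i, Measurable (X i))
    {n m m' : ℕ} (hm : n ≤ m) (hm' : n ≤ m') {C : Set (Fin n → 𝕏)} (hC : MeasurableSet C) :
    (μ.restrict ((fun ω (i : Fin n) => X i ω) ⁻¹' C)).map (X m) =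
      (μ.restrict ((fun ω (i : Fin n) => X i ω) ⁻¹' C)).map (X m') := by
  ext A hA
  have hfin : {i | Equiv.swap m m' i ≠ i}.Finite := by
    refine Set.Finite.subset (Set.toFinite {m, m'}) fun i hi => ?_
    by_contra h
    simp only [Set.mem_insert_iff, Set.mem_singleton_iff, not_or] at h
    exact hi (Equiv.swap_apply_of_ne_of_ne h.1 h.2)
  -- The swap moves only indices `≥ n`, so it leaves the past event `C` unchanged.
  let D : Set (ℕ → 𝕏) := {x | x m' ∈ A} ∩ (fun x (i : Fin n) => x i) ⁻¹' C
  have hD : MeasurableSet D :=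
    (measurable_pi_apply m' hA).inter ((measurable_pi_lambda _ fun i => measurable_pi_apply _) hC)
  have h := (hexch _ hfin).measure_mem_eq hD
  rw [Measure.map_apply (hX m) hA, Measure.map_apply (hX m') hA,
    Measure.restrict_apply (hX m hA), Measure.restrict_apply (hX m' hA)]
  refine Eq.trans ?_ h
  congr 1
  ext ω
  simp only [D, Set.mem_inter_iff, Set.mem_preimage, Set.mem_ofPred_eq, Equiv.swap_apply_right]
  have : ∀ i : Fin n, Equiv.swap m m' i = i := fun i =>
    Equiv.swap_apply_of_ne_of_ne (by omega) (by omega)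
  simp only [this]

/-! ### Continuity sets as a generating π-system. -/

/-- The Borel sets whose boundary is a null set generate the Borel `σ`-algebra. -/
lemma borel_eq_generateFrom_null_frontier {𝕏 : Type*} [TopologicalSpace 𝕏]
    [TopologicalSpace.PseudoMetrizableSpace 𝕏] [MeasurableSpace 𝕏] [BorelSpace 𝕏] (P : Measure 𝕏)
    [SFinite P] :
    ‹MeasurableSpace 𝕏› =
      MeasurableSpace.generateFrom {A | MeasurableSet A ∧ P (frontier A) = 0} := by
  let := TopologicalSpace.pseudoMetrizableSpacePseudoMetric 𝕏
  refine le_antisymm ?_ (MeasurableSpace.generateFrom_le fun A hA => hA.1)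
  refine (BorelSpace.measurable_eq.trans borel_eq_generateFrom_isClosed).le.trans
    (MeasurableSpace.generateFrom_le fun C hC => ?_)
  obtain ⟨r, hr, hr'⟩ := exists_null_frontiers_thickening P C
  have : C = ⋂ n, Metric.thickening (r n) C := by
    refine Set.Subset.antisymm
      (Set.subset_iInter fun n => Metric.self_subset_thickening (hr' n).1 C) fun x hx => ?_
    rw [← IsClosed.closure_eq hC, Metric.mem_closure_iff]
    intro ε hε
    obtain ⟨n, hn⟩ := (hr.eventually_lt_const hε).exists
    obtain ⟨y, hy, hxy⟩ := Metric.mem_thickening_iff.1 (Set.mem_iInter.1 hx n)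
    exact ⟨y, hy, hxy.trans hn⟩
  have hgen : @MeasurableSet 𝕏
      (MeasurableSpace.generateFrom {A | MeasurableSet A ∧ P (frontier A) = 0})
      (⋂ n, Metric.thickening (r n) C) :=
    MeasurableSet.iInter fun n => MeasurableSpace.measurableSet_generateFrom
      ⟨Metric.isOpen_thickening.measurableSet, (hr' n).2⟩
  rwa [← this] at hgen

lemma isPiSystem_null_frontier {𝕏 : Type*} [TopologicalSpace 𝕏] [MeasurableSpace 𝕏]
    (P : Measure 𝕏) : IsPiSystem {A | MeasurableSet A ∧ P (frontier A) = 0} := by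
  rintro A ⟨hA, hA'⟩ B ⟨hB, hB'⟩ -
  refine ⟨hA.inter hB, measure_mono_null (frontier_inter_subset A B) ?_⟩
  exact measure_union_null (measure_mono_null Set.inter_subset_left hA')
    (measure_mono_null Set.inter_subset_right hB')

/-! ### Factorization of a random measure through a statistic. -/

/-- A random probability measure whose values on a generating `π`-system are almost surely
functions of a random variable `θ` is itself almost surely a probability kernel applied to `θ`. -/
lemma exists_kernel_ae_eq_comp {Ω E 𝕏 : Type*} [MeasurableSpace Ω] [MeasurableSpace E]
    [mX : MeasurableSpace 𝕏] [StandardBorelSpace 𝕏] [Nonempty 𝕏] {μ : Measure Ω}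
    [IsProbabilityMeasure μ] (κ : Kernel Ω 𝕏) [IsMarkovKernel κ] {θ : Ω → E}
    (hθ : AEMeasurable θ μ) {C : Set (Set 𝕏)} (hC : mX = MeasurableSpace.generateFrom C)
    (hpi : IsPiSystem C)
    (h : ∀ A ∈ C, ∃ g : E → ℝ≥0∞, Measurable g ∧ ∀ᵐ ω ∂μ, κ ω A = g (θ ω)) :
    ∃ F : Kernel E 𝕏, IsMarkovKernel F ∧ ∀ᵐ ω ∂μ, κ ω = F (θ ω) := by
  wlog hθm : Measurable θ generalizing θ
  · obtain ⟨F, hF, hF'⟩ := this hθ.measurable_mk.aemeasurable (fun A hA => by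
      obtain ⟨g, hg, hg'⟩ := h A hA
      refine ⟨g, hg, ?_⟩
      filter_upwards [hg', hθ.ae_eq_mk] with ω h₁ h₂
      rw [h₁, h₂]) hθ.measurable_mk
    refine ⟨F, hF, ?_⟩
    filter_upwards [hF', hθ.ae_eq_mk] with ω h₁ h₂
    rw [h₁, h₂]
  -- The joint law of `θ` and a draw from `κ`; its conditional kernel given `θ` is the candidate for
  -- `F`.
  let ρ : Measure (E × 𝕏) := (μ ⊗ₘ κ).map (Prod.map θ id)
  have hprod : Measurable (Prod.map θ (id : 𝕏 → 𝕏)) := hθm.prodMap measurable_id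
  have : IsProbabilityMeasure ρ := Measure.isProbabilityMeasure_map hprod.aemeasurable
  have hρ : ∀ (D : Set E) (A : Set 𝕏), MeasurableSet D → MeasurableSet A →
      ρ (D ×ˢ A) = ∫⁻ ω in θ ⁻¹' D, κ ω A ∂μ := by
    intro D A hD hA
    rw [Measure.map_apply hprod (hD.prod hA)]
    exact Measure.compProd_apply_prod (hθm hD) hA
  have hfst : ρ.fst = μ.map θ := by
    ext D hD
    rw [Measure.fst_apply hD, Measure.map_apply hθm hD, ← Set.prod_univ,
      hρ D _ hD MeasurableSet.univ]
    simp
  refine ⟨ρ.condKernel, inferInstance, ?_⟩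
  have hbasic : ∀ A ∈ C, ∀ᵐ ω ∂μ, κ ω A = ρ.condKernel (θ ω) A := by
    intro A hA
    have hAm : MeasurableSet A := by
      rw [hC]
      exact MeasurableSpace.measurableSet_generateFrom hA
    obtain ⟨g, hg, hg'⟩ := h A hA
    have key : g =ᵐ[μ.map θ] fun t => ρ.condKernel t A := by
      have : IsProbabilityMeasure (μ.map θ) := Measure.isProbabilityMeasure_map hθ
      refine ae_eq_of_forall_setLIntegral_eq_of_sigmaFinite hg
        (Kernel.measurable_coe _ hAm) fun D hD _ => ?_
      rw [← hfst, Measure.setLIntegral_condKernel_eq_measure_prod hD hAm, hρ D A hD hAm, hfst,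
        setLIntegral_map hD hg hθm]
      exact lintegral_congr_ae (ae_restrict_of_ae (hg'.mono fun ω hω => hω.symm))
    filter_upwards [hg', ae_of_ae_map hθ key] with ω h₁ h₂
    rw [h₁, h₂]
  have hall : ∀ A, MeasurableSet A → ∀ᵐ ω ∂μ, κ ω A = ρ.condKernel (θ ω) A := by
    refine MeasurableSpace.induction_on_inter hC hpi (by simp) hbasic ?_ ?_
    · intro A hA h
      filter_upwards [h] with ω hω
      rw [prob_compl_eq_one_sub hA, prob_compl_eq_one_sub hA, hω]
    · intro f hd hf h
      filter_upwards [ae_all_iff.2 h] with ω hω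
      rw [measure_iUnion hd hf, measure_iUnion hd hf]
      exact tsum_congr hω
  -- The null set in `hall` depends on `A`; uniqueness of disintegrations yields a single one.
  have heq : κ =ᵐ[μ] ρ.condKernel.comap θ hθm := by
    refine Kernel.ae_eq_of_compProd_eq (Measure.ext_prod fun {B A} hB hA => ?_)
    rw [Measure.compProd_apply_prod hB hA, Measure.compProd_apply_prod hB hA]
    exact lintegral_congr_ae (ae_restrict_of_ae (by simpa using hall A hA))
  exact heq

/-! ### Predictive probabilities and martingale convergence. -/

/-- The filtration whose `n`-th `σ`-algebra is generated by the tuple `(X 0, …, X n)`. -/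
def pastFiltration {Ω 𝕏 : Type*} [mΩ : MeasurableSpace Ω] [MeasurableSpace 𝕏] {X : ℕ → Ω → 𝕏}
    (hX : ∀ i, Measurable (X i)) : Filtration ℕ mΩ where
  seq n := MeasurableSpace.comap (fun ω (i : Fin (n + 1)) => X i ω) inferInstance
  mono' n m hnm := by
    have hr : Measurable fun (z : Fin (m + 1) → 𝕏) (i : Fin (n + 1)) =>
        z (Fin.castLE (Nat.succ_le_succ hnm) i) :=
      measurable_pi_lambda _ fun i => measurable_pi_apply _
    rintro _ ⟨C, hC, rfl⟩
    exact ⟨_, hr hC, rfl⟩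
  le' n := (measurable_pi_lambda _ fun i : Fin (n + 1) => hX i).comap_le

lemma measurable_pastFiltration {Ω 𝕏 : Type*} [MeasurableSpace Ω] [MeasurableSpace 𝕏]
    {X : ℕ → Ω → 𝕏} (hX : ∀ i, Measurable (X i)) {i n : ℕ} (hi : i ≤ n) :
    Measurable[pastFiltration hX n] (X i) := fun _ hA =>
  ⟨_, measurable_pi_apply (⟨i, Nat.lt_succ_of_le hi⟩ : Fin (n + 1)) hA, rfl⟩

section Directing

variable {Ω 𝕏 : Type*} [MeasurableSpace Ω] {μ : Measure Ω} [IsProbabilityMeasure μ]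
  [TopologicalSpace 𝕏] [MeasurableSpace 𝕏] [BorelSpace 𝕏] [HasOuterApproxClosed 𝕏]
  {X : ℕ → Ω → 𝕏} {Fdir : Ω → ProbabilityMeasure 𝕏}

/-- The common law of the terms is the mean of the directing measure. -/
lemma IsDirectingMeasure.map_eq_bind (hF : IsDirectingMeasure X μ Fdir)
    (hexch : Exchangeable X μ) (hX : ∀ i, Measurable (X i)) :
    μ.map (X 0) = μ.bind fun ω => (Fdir ω : Measure 𝕏) := by
  refine map_eq_bind_of_tendsto_empiricalMeasure hX hF.1 hF.2 fun m _ => ?_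
  simpa using hexch.restrict_map_eq hX (Nat.zero_le m) le_rfl MeasurableSet.univ

/-- The predictive probabilities are the conditional expectations of the directing measure. -/
lemma IsDirectingMeasure.condExp_ae_eq (hF : IsDirectingMeasure X μ Fdir)
    (hexch : Exchangeable X μ) (hX : ∀ i, Measurable (X i)) (n : ℕ) {A : Set 𝕏}
    (hA : MeasurableSet A) :
    μ⟦X (n + 1) ⁻¹' A | pastFiltration hX n⟧ =ᵐ[μ]
      μ[fun ω => (Fdir ω : Measure 𝕏).real A | pastFiltration hX n] := by
  have hF' : Measurable fun ω => (Fdir ω : Measure 𝕏) := measurable_subtype_coe.comp hF.1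
  have hFA : Measurable fun ω => (Fdir ω : Measure 𝕏) A := (Measure.measurable_coe hA).comp hF'
  have hint : Integrable (fun ω => (Fdir ω : Measure 𝕏).real A) μ :=
    Integrable.of_bound hFA.ennreal_toReal.aestronglyMeasurable 1 (.of_forall fun ω => by
      rw [Real.norm_of_nonneg measureReal_nonneg]
      exact measureReal_le_one)
  refine ae_eq_condExp_of_forall_setIntegral_eq ((pastFiltration hX).le n) hint
    (fun _ _ _ => integrable_condExp.integrableOn) (fun B hB _ => ?_)
    stronglyMeasurable_condExp.aestronglyMeasurable
  have hBm := (pastFiltration hX).le n B hB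
  rw [setIntegral_condExp ((pastFiltration hX).le n)
    ((integrable_const _).indicator (hX (n + 1) hA)) hB]
  obtain ⟨C, hC, rfl⟩ := hB
  -- Under `μ` restricted to a past event, the terms from index `n + 1` on still share one law.
  have key := map_eq_bind_of_tendsto_empiricalMeasure hX hF.1 (ae_restrict_of_ae hF.2)
    (m₀ := n + 1) fun m hm => hexch.restrict_map_eq hX hm le_rfl hC
  have key' := congrArg (fun ν => ν A) key
  simp only [Measure.map_apply (hX _) hA, Measure.bind_apply hA hF'.aemeasurable] at key'
  rw [integral_indicator_const _ (hX _ hA), smul_eq_mul, mul_one, measureReal_def, key']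
  exact (integral_toReal hFA.aemeasurable (.of_forall fun ω => measure_lt_top _ _)).symm

/-- A nonnegative variable with mean zero vanishes a.s. Applied to frontiers, this lets weak
convergence be evaluated on P₀-continuity sets. -/
lemma IsDirectingMeasure.ae_null_of_map_null (hF : IsDirectingMeasure X μ Fdir)
    (hexch : Exchangeable X μ) (hX : ∀ i, Measurable (X i)) {A : Set 𝕏} (hA : MeasurableSet A)
    (h : μ.map (X 0) A = 0) : ∀ᵐ ω ∂μ, (Fdir ω : Measure 𝕏) A = 0 := by
  have hF' : Measurable fun ω => (Fdir ω : Measure 𝕏) := measurable_subtype_coe.comp hF.1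
  rw [hF.map_eq_bind hexch hX, Measure.bind_apply hA hF'.aemeasurable] at h
  exact (lintegral_eq_zero_iff ((Measure.measurable_coe hA).comp hF')).1 h

/-- The predictive probabilities of a continuity set converge almost surely to the values of the
directing measure. -/
lemma IsDirectingMeasure.tendsto_condExp (hF : IsDirectingMeasure X μ Fdir)
    (hexch : Exchangeable X μ) (hX : ∀ i, Measurable (X i)) {A : Set 𝕏} (hA : MeasurableSet A)
    (hA₀ : μ.map (X 0) (frontier A) = 0) :
    ∀ᵐ ω ∂μ, Tendsto (fun n => (μ⟦X (n + 1) ⁻¹' A | pastFiltration hX n⟧) ω) atTop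
      (𝓝 ((Fdir ω : Measure 𝕏).real A)) := by
  let ℱ := pastFiltration hX
  have hle : ⨆ n, ℱ n ≤ ‹MeasurableSpace Ω› := iSup_le ℱ.le
  have hF' : Measurable fun ω => (Fdir ω : Measure 𝕏) := measurable_subtype_coe.comp hF.1
  have hFA : Measurable fun ω => (Fdir ω : Measure 𝕏) A := (Measure.measurable_coe hA).comp hF'
  have hint : Integrable (fun ω => (Fdir ω : Measure 𝕏).real A) μ :=
    Integrable.of_bound hFA.ennreal_toReal.aestronglyMeasurable 1 (.of_forall fun ω => by
      rw [Real.norm_of_nonneg measureReal_nonneg]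
      exact measureReal_le_one)
  have hnull := hF.ae_null_of_map_null hexch hX isClosed_frontier.measurableSet hA₀
  let e : ℕ → Ω → ℝ := fun n ω =>
    (empiricalMeasure (fun i => X i ω) n : Measure 𝕏).real A
  have he : ∀ n, Measurable[⨆ n, ℱ n] (e n) := fun n =>
    (((Measure.measurable_coe hA).comp (measurable_subtype_coe.comp
      (@measurable_empiricalMeasure 𝕏 _ Ω (ℱ n) n X fun i hi =>
        measurable_pastFiltration hX hi))).ennreal_toReal).mono (le_iSup _ n) le_rfl
  have helim : ∀ᵐ ω ∂μ, Tendsto (fun n => e n ω) atTop (𝓝 ((Fdir ω : Measure 𝕏).real A)) := by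
    filter_upwards [hF.2, hnull] with ω h₁ h₂
    exact (ENNReal.tendsto_toReal (measure_ne_top _ _)).comp
      (ProbabilityMeasure.tendsto_measure_of_null_frontier_of_tendsto' h₁ h₂)
  -- The limsup is a version of F̃(A) measurable with respect to the whole past, which F̃(A) itself
  -- need not be.
  have hlimsup : (fun ω => (Fdir ω : Measure 𝕏).real A) =ᵐ[μ]
      fun ω => limsup (fun n => e n ω) atTop :=
    helim.mono fun ω hω => hω.limsup_eq.symm
  have haem : AEStronglyMeasurable[⨆ n, ℱ n] (fun ω => (Fdir ω : Measure 𝕏).real A) μ :=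
    ⟨_, (Measurable.limsup he).stronglyMeasurable, hlimsup⟩
  have hcond := condExp_of_aestronglyMeasurable' hle haem hint
  filter_upwards [tendsto_ae_condExp (μ := μ) (ℱ := ℱ) fun ω => (Fdir ω : Measure 𝕏).real A,
    hcond, ae_all_iff.2 fun n => hF.condExp_ae_eq hexch hX n hA] with ω h₁ h₂ h₃
  rw [h₂] at h₁
  exact h₁.congr fun n => (h₃ n).symm

end Directing

/-! ### Predictive sufficiency. -/

/-- A statistic of the empirical measure is almost surely a measurable function of the sample. -/
lemma exists_measurable_comp_sample {Ω 𝕏 E : Type*} [MeasurableSpace Ω] {μ : Measure Ω}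
    [TopologicalSpace 𝕏] [SecondCountableTopology 𝕏] [MeasurableSpace 𝕏] [BorelSpace 𝕏]
    [TopologicalSpace E] [MeasurableSpace E] [BorelSpace E]
    {X : ℕ → Ω → 𝕏} (hX : ∀ i, Measurable (X i)) {M : Set (ProbabilityMeasure 𝕏)}
    (hM : MeasurableSet M) {T : ProbabilityMeasure 𝕏 → E} (hT : ContinuousOn T M) {n : ℕ}
    (hemp : ∀ᵐ ω ∂μ, empiricalMeasure (fun i => X i ω) n ∈ M) :
    ∃ h : (Fin (n + 1) → 𝕏) → E, Measurable h ∧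
      ∀ᵐ ω ∂μ, T (empiricalMeasure (fun i => X i ω) n) = h fun i => X i ω := by
  let Z : Ω → Fin (n + 1) → 𝕏 := fun ω i => X i ω
  have hZ : Measurable Z := measurable_pi_lambda _ fun i => hX i
  -- Extends a tuple to a sequence by repeating its last entry; the empirical measure at `n` does
  -- not see the extension.
  let Y : ℕ → (Fin (n + 1) → 𝕏) → 𝕏 := fun i z => z ⟨min i n, by omega⟩
  have hY : ∀ i, Measurable (Y i) := fun i => measurable_pi_apply _
  have hemp' : ∀ ω, empiricalMeasure (fun i => Y i (Z ω)) n =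
      empiricalMeasure (fun i => X i ω) n := by
    intro ω
    refine Subtype.ext ?_
    simp only [empiricalMeasure, Y, Z]
    congr 1
    refine Finset.sum_congr rfl fun i hi => ?_
    rw [min_eq_left (Nat.lt_succ_iff.1 (Finset.mem_range.1 hi))]
  have hae := aemeasurable_comp_empiricalMeasure (μ := μ.map Z) hY hM hT (n := n)
    ((ae_map_iff hZ.aemeasurable (measurable_empiricalMeasure n (fun i _ => hY i) hM)).2
      (by simpa only [hemp'] using hemp))
  refine ⟨hae.mk, hae.measurable_mk, ?_⟩
  filter_upwards [ae_of_ae_map hZ.aemeasurable hae.ae_eq_mk] with ω hω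
  rw [← hemp' ω]
  exact hω

/-- Under predictive sufficiency, the predictive distribution is the conditional distribution of
the next observation given the statistic. -/
lemma IsPredictiveSufficient.predictive_ae_eq {Ω 𝕏 E : Type*} [MeasurableSpace Ω]
    [MeasurableSpace 𝕏] [StandardBorelSpace 𝕏] [Nonempty 𝕏] [MeasurableSpace E]
    {X : ℕ → Ω → 𝕏} {μ : Measure Ω} [IsProbabilityMeasure μ] {T : ProbabilityMeasure 𝕏 → E}
    (hsuff : IsPredictiveSufficient X μ T) (hX : ∀ i, Measurable (X i)) {n : ℕ}
    {h : (Fin (n + 1) → 𝕏) → E} (hh : Measurable h)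
    (hT : ∀ᵐ ω ∂μ, T (empiricalMeasure (fun i => X i ω) n) = h fun i => X i ω)
    (q : Kernel E 𝕏) [IsMarkovKernel q]
    (hq : (μ.map (fun ω =>
      (T (empiricalMeasure (fun i => X i ω) n), X (n + 1) ω))).IsCondKernel q) :
    ∀ᵐ ω ∂μ, predictive X μ n ω = q (T (empiricalMeasure (fun i => X i ω) n)) := by
  obtain ⟨κ, hκ, hpred⟩ := hsuff n
  let Z : Ω → Fin (n + 1) → 𝕏 := fun ω i => X i ω
  have hZ : Measurable Z := measurable_pi_lambda _ fun i => hX i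
  have hS : Measurable fun ω => h (Z ω) := hh.comp hZ
  have hρ : μ.map (fun ω => (T (empiricalMeasure (fun i => X i ω) n), X (n + 1) ω)) =
      μ.map fun ω => (h (Z ω), X (n + 1) ω) :=
    Measure.map_congr (hT.mono fun ω hω => Prod.ext hω rfl)
  have hq' := hq.disintegrate
  rw [hρ, Measure.fst_map_prodMk (hX (n + 1))] at hq'
  have : IsProbabilityMeasure (μ.map fun ω => h (Z ω)) :=
    Measure.isProbabilityMeasure_map hS.aemeasurable
  -- An event `h (Z ω) ∈ D` concerns the sample, so integrating the predictive law over it gives the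
  -- joint law. Hence `κ` and `q` disintegrate the same measure.
  have hκ' : (μ.map fun ω => h (Z ω)) ⊗ₘ κ = μ.map fun ω => (h (Z ω), X (n + 1) ω) := by
    refine Measure.ext_prod fun {D A} hD hA => ?_
    rw [Measure.compProd_apply_prod hD hA, Measure.map_apply (hS.prodMk (hX _)) (hD.prod hA),
      setLIntegral_map hD (Kernel.measurable_coe _ hA) hS]
    have key := setLIntegral_preimage_condDistrib (μ := μ) hZ (hX (n + 1)).aemeasurable hA (hh hD)
    refine Eq.trans ?_ key
    refine lintegral_congr_ae (ae_restrict_of_ae ?_)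
    filter_upwards [hT, hpred] with ω h₁ h₂
    rw [← h₁, ← h₂]
    rfl
  have heq := Kernel.ae_eq_of_compProd_eq (hκ'.trans hq'.symm)
  filter_upwards [hT, hpred, ae_of_ae_map hS.aemeasurable heq] with ω h₁ h₂ h₃
  rw [h₂, h₁]
  exact h₃

end PredictiveSufficiency

open PredictiveSufficiency in
/-- Indices are shifted by one: `X 0, X 1, …` are the observations, and index `n` of the empirical
measures, of the statistic and of `q` refers to the sample size `n + 1`. The values of `T` off `M`
and of `q n` off `𝕋` are irrelevant. -/
theorem mainTheorem4
    {Ω : Type*} [MeasurableSpace Ω] (μ : Measure Ω) [IsProbabilityMeasure μ]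
    {𝕏 : Type*} [TopologicalSpace 𝕏] [PolishSpace 𝕏] [MeasurableSpace 𝕏] [BorelSpace 𝕏]
    [Nonempty 𝕏]
    (X : ℕ → Ω → 𝕏) (hX : ∀ i, Measurable (X i)) (hexch : Exchangeable X μ)
    (Fdir : Ω → ProbabilityMeasure 𝕏) (hFdir : IsDirectingMeasure X μ Fdir)
    (k : ℕ) (𝕋 : Set (EuclideanSpace ℝ (Fin k))) (h𝕋 : MeasurableSet 𝕋)
    (M : Set (ProbabilityMeasure 𝕏)) (hM : MeasurableSet M)
    (hFdirM : ∀ᵐ ω ∂μ, Fdir ω ∈ M)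
    (hempM : ∀ n, ∀ᵐ ω ∂μ, empiricalMeasure (fun i => X i ω) n ∈ M)
    (T : ProbabilityMeasure 𝕏 → EuclideanSpace ℝ (Fin k))
    (hTcont : ContinuousOn T M) (hTmaps : Set.MapsTo T M 𝕋)
    (hsuff : IsPredictiveSufficient X μ T)
    (q : ℕ → Kernel (EuclideanSpace ℝ (Fin k)) 𝕏) (hqprob : ∀ n, IsMarkovKernel (q n))
    (hq : ∀ n, (μ.map (fun ω =>
      (T (empiricalMeasure (fun i => X i ω) n), X (n + 1) ω))).IsCondKernel (q n))
    (hqcont : ∀ A : Set 𝕏, MeasurableSet A → μ.map (X 0) (frontier A) = 0 →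
      UniformEquicontinuousOn (fun n t => (q n t).real A) 𝕋) :
    ∃ F : Kernel (EuclideanSpace ℝ (Fin k)) 𝕏, IsMarkovKernel F ∧
      (∀ᵐ ω ∂μ, (Fdir ω : Measure 𝕏) = F (T (Fdir ω))) ∧
      ∀ᵐ ω ∂μ, Tendsto (fun n => T (empiricalMeasure (fun i => X i ω) n)) atTop
        (𝓝 (T (Fdir ω))) := by
  have hlim : ∀ᵐ ω ∂μ, Tendsto (fun n => T (empiricalMeasure (fun i => X i ω) n)) atTop
      (𝓝 (T (Fdir ω))) := by
    filter_upwards [hFdir.2, hFdirM, ae_all_iff.2 hempM] with ω h₁ h₂ h₃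
    exact (hTcont _ h₂).tendsto.comp
      (tendsto_nhdsWithin_iff.2 ⟨h₁, Eventually.of_forall h₃⟩)
  have hTn := fun n => aemeasurable_comp_empiricalMeasure hX hM hTcont (hempM n)
  have hθ : AEMeasurable (fun ω => T (Fdir ω)) μ :=
    aemeasurable_of_tendsto_metrizable_ae' hTn hlim
  let κ : Kernel Ω 𝕏 :=
    ⟨fun ω => (Fdir ω : Measure 𝕏), measurable_subtype_coe.comp hFdir.1⟩
  have : IsMarkovKernel κ := ⟨fun ω => inferInstanceAs (IsProbabilityMeasure (Fdir ω : Measure 𝕏))⟩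
  have : IsProbabilityMeasure (μ.map (X 0)) :=
    Measure.isProbabilityMeasure_map (hX 0).aemeasurable
  have hpred : ∀ n, ∀ᵐ ω ∂μ,
      predictive X μ n ω = q n (T (empiricalMeasure (fun i => X i ω) n)) := by
    intro n
    obtain ⟨h, hh, hTh⟩ := exists_measurable_comp_sample hX hM hTcont (hempM n)
    have := hqprob n
    exact hsuff.predictive_ae_eq hX hh hTh (q n) (hq n)
  obtain ⟨F, hF, hFκ⟩ := exists_kernel_ae_eq_comp κ hθ
    (borel_eq_generateFrom_null_frontier (μ.map (X 0))) (isPiSystem_null_frontier (μ.map (X 0)))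
    (by
      rintro A ⟨hA, hA₀⟩
      -- The limit may fail to exist at other `t`; the limsup is measurable everywhere.
      refine ⟨fun t => limsup (fun n => q n t A) atTop,
        Measurable.limsup fun n => Kernel.measurable_coe _ hA, ?_⟩
      have hcond : ∀ n, (fun ω => (predictive X μ n ω).real A) =ᵐ[μ]
          μ⟦X (n + 1) ⁻¹' A | pastFiltration hX n⟧ := fun n =>
        condDistrib_ae_eq_condExp (measurable_pi_lambda _ fun i : Fin (n + 1) => hX i)
          (hX (n + 1)) hA
      filter_upwards [hFdir.tendsto_condExp hexch hX hA hA₀, ae_all_iff.2 hcond,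
        ae_all_iff.2 hpred, hlim, hFdirM, ae_all_iff.2 hempM] with ω h₁ h₂ h₃ h₄ h₅ h₆
      have h₇ : Tendsto (fun n => (q n (T (empiricalMeasure (fun i => X i ω) n))).real A) atTop
          (𝓝 ((Fdir ω : Measure 𝕏).real A)) :=
        h₁.congr fun n => by rw [← h₂ n, h₃ n]
      have h₈ : Tendsto (fun n => (q n (T (Fdir ω))).real A) atTop
          (𝓝 ((Fdir ω : Measure 𝕏).real A)) := by
        refine h₇.congr_dist (Metric.tendsto_atTop.2 fun ε hε => ?_)
        -- Equicontinuity holds only on `𝕋`, so both points must be kept inside it.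
        have hpair : Tendsto (fun n => (T (empiricalMeasure (fun i => X i ω) n), T (Fdir ω))) atTop
            (uniformity _ ⊓ 𝓟 (𝕋 ×ˢ 𝕋)) :=
          tendsto_inf.2 ⟨Uniform.tendsto_nhds_left.1 h₄, tendsto_principal.2
            (Eventually.of_forall fun n => ⟨hTmaps (h₆ n), hTmaps h₅⟩)⟩
        obtain ⟨N, hN⟩ := eventually_atTop.1
          (hpair.eventually (hqcont A hA hA₀ _ (Metric.dist_mem_uniformity hε)))
        refine ⟨N, fun n hn => ?_⟩
        rw [Real.dist_0_eq_abs, abs_of_nonneg dist_nonneg]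
        exact hN n hn n
      have h₉ : Tendsto (fun n => q n (T (Fdir ω)) A) atTop (𝓝 ((Fdir ω : Measure 𝕏) A)) := by
        have := fun n => hqprob n
        exact (ENNReal.tendsto_toReal_iff (fun n => measure_ne_top _ _) (measure_ne_top _ _)).1 h₈
      exact h₉.limsup_eq.symm)
  exact ⟨F, hF, hFκ, hlim⟩
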